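/- A real-valued logarithmic derivative of degree $m\ge 1$ is a function $\rho(x)=P'(x)/P(x)=\sum_{k=1}^m \frac{1}{x-z_k}$, where $P(x)=\prod_{k=1}^m (x-z_k)$ is a monic polynomial with real coefficients. For $n\in\mathbb N$ and $a\in\mathbb R$ let $\mathfrak R_n(a)$ be the set of all real-valued logarithmic derivatives of degree at most $n$ that have a pole at $x=a$, and put $\|\rho\|=\max_{x\in[-1,1]}|\rho(x)|$ (with $\|\rho\|=\infty$ if $\rho$ has a pole on $[-1,1]$). Let $T_n$ be the Chebyshev polynomials of the first kind. Let $n\ge 4$ and $a>\sqrt2\,(3\sqrt n)^{1/n}$. Then there is an element of $\mathfrak R_n(a)$ of least norm $\|\cdot\|$. If $\widetilde\rho_n=\widetilde\rho_n(a;\cdot)$ denotes any such element, then $$\|\widetilde\rho_n\|\asymp\frac{2n}{T_n(a)-T_{n-2}(a)},\qquad n\ge 4,$$ that is, there are absolute constants $0<\alpha\le\beta<\infty$ such that the ratio of the left side to the right side lies in $[\alpha,\beta]$ for all such $n$ and $a$. Moreover, as $n\to\infty$ the sign $\asymp$ can be replaced by $\sim$: the ratio tends to $1$ as $n\to\infty$,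 uniformly in $a>\sqrt2\,(3\sqrt n)^{1/n}$ (in particular for every fixed $a>\sqrt2$). -/

import Mathlib

open Polynomial

noncomputable section

/-- The logarithmic derivative `P' / P` of a real polynomial, as a function of a real variable.
For monic `P` of degree `m` with complex zeros `z₁, …, z_m` (listed with multiplicity) it is
`x ↦ ∑ 1 / (x - z_k)`; such functions are exactly the real-valued logarithmic derivatives of
degree `m`, i.e. those whose poles are symmetric with respect to the real line. -/
def logDer (P : ℝ[X]) (x : ℝ) : ℝ :=
  (derivative P).eval x / P.eval x

/-- The real monic polynomials of degree at most `n` that vanish at `a`. Their logarithmic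
derivatives are the real-valued logarithmic derivatives of degree at most `n` with pole `a`. -/
def FixedPole (n : ℕ) (a : ℝ) : Set ℝ[X] :=
  {P | P.Monic ∧ P.natDegree ≤ n ∧ P.IsRoot a}

/-- The logarithmic derivative of `P` has no pole on `[-1, 1]`, i.e. its maximum modulus there is
finite. -/
def PoleFree (P : ℝ[X]) : Prop :=
  ∀ x ∈ Set.Icc (-1 : ℝ) 1, P.eval x ≠ 0

/-- The uniform norm on `[-1, 1]` (a maximum, for functions continuous there). -/
def unifNorm (f : ℝ → ℝ) : ℝ :=
  sSup ((fun x => |f x|) '' Set.Icc (-1 : ℝ) 1)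

/-- `P'/P` deviates least from zero on `[-1, 1]` in the uniform norm among all real-valued
logarithmic derivatives of degree at most `n` with pole `a`. Competitors with a pole on `[-1, 1]`
have infinite norm, so only pole-free ones have to be compared. -/
def IsLeastDeviating (n : ℕ) (a : ℝ) (P : ℝ[X]) : Prop :=
  P ∈ FixedPole n a ∧ PoleFree P ∧
    ∀ Q ∈ FixedPole n a, PoleFree Q → unifNorm (logDer P) ≤ unifNorm (logDer Q)

/-- The comparison quantity `2n / (T_n(a) - T_{n-2}(a))`. -/
def chebRate (n : ℕ) (a : ℝ) : ℝ :=
  2 * n / ((Chebyshev.T ℝ (n : ℤ)).eval a - (Chebyshev.T ℝ ((n : ℤ) - 2)).eval a)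

/-- The condition `n ≥ 4` and `a > √2 · (3√n)^{1/n}`. -/
def Admissible (n : ℕ) (a : ℝ) : Prop :=
  4 ≤ n ∧ √2 * (3 * √(n : ℝ)) ^ (1 / (n : ℝ)) < a

end

/-! Scale `P` to `Q` with `Q(0) = 1`; then norm at most `M` means `|Q'| ≤ M Q` on `[-1, 1]`, and
Grönwall gives `e^{-M} ≤ Q ≤ e^M` there. Such `Q` and `M` form a closed set, compact for bounded
`M`, so a least `M` exists.

Let `F` be the primitive `chebPrimitive` of `T_{n-1}`. Lower bound: `|Q'| ≤ M e^M` on `[-1, 1]`, so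
extremality of Chebyshev polynomials outside the interval gives `Q' ≥ -M e^M T_{n-1}` on `[1, a]`.
Integrating from `1` to the zero `a` yields `1 ≤ M e^{2M} (F(a) - F(1))`
(`NormalizedBound.one_le_mul_exp`). Upper bound: the competitor `F(a) - F(x)` has derivative
`-T_{n-1}` and is nearly constant on `[-1, 1]` relative to `F(a)` (`IsLeastDeviating.unifNorm_le`).

Up to lower-order terms both bounds are `1 / F(a)`, hence the rate; exponential growth of
`U_{n-2}(a)` makes `M` small and `e^{2M}` close to `1`. -/

open Set in
theorem abs_derivative_le_unifNorm_logDer_mul {P : ℝ[X]} (hP : PoleFree P) {x : ℝ}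
    (hx : x ∈ Icc (-1 : ℝ) 1) :
    |(derivative P).eval x| ≤ unifNorm (logDer P) * |P.eval x| := by
  have hc : ContinuousOn (fun x => |logDer P x|) (Icc (-1 : ℝ) 1) :=
    (ContinuousOn.div (derivative P).continuous.continuousOn P.continuous.continuousOn hP).abs
  have hle : |logDer P x| ≤ unifNorm (logDer P) :=
    le_csSup (isCompact_Icc.image_of_continuousOn hc).bddAbove (mem_image_of_mem _ hx)
  rwa [logDer, abs_div, div_le_iff₀ (abs_pos.mpr (hP x hx))] at hle

theorem unifNorm_logDer_le {P : ℝ[X]} (hP : PoleFree P) {M : ℝ}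
    (h : ∀ x ∈ Set.Icc (-1 : ℝ) 1, |(derivative P).eval x| ≤ M * |P.eval x|) :
    unifNorm (logDer P) ≤ M := by
  refine csSup_le ⟨_, Set.mem_image_of_mem _ (Set.mem_Icc.mpr ⟨by norm_num, zero_le_one⟩)⟩ ?_
  rintro _ ⟨x, hx, rfl⟩
  show |logDer P x| ≤ M
  rw [logDer, abs_div, div_le_iff₀ (abs_pos.mpr (hP x hx))]
  exact h x hx

theorem unifNorm_nonneg (f : ℝ → ℝ) : 0 ≤ unifNorm f :=
  Real.sSup_nonneg (by rintro _ ⟨x, -, rfl⟩; exact abs_nonneg _)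

/-! ### Normalized polynomials and existence of a minimizer -/

/-- Polynomials of degree at most `n` with zero `a`, scaled to be `1` at the origin and positive
on `[-1, 1]`, whose logarithmic derivative is bounded by `M` there. -/
structure NormalizedBound (n : ℕ) (a M : ℝ) (Q : ℝ[X]) : Prop where
  natDegree_le : Q.natDegree ≤ n
  eval_pole : Q.eval a = 0
  eval_zero : Q.eval 0 = 1
  abs_derivative_le : ∀ x ∈ Set.Icc (-1 : ℝ) 1, |(derivative Q).eval x| ≤ M * Q.eval x

namespace NormalizedBound

variable {n : ℕ} {a M : ℝ} {Q : ℝ[X]}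

/-- Grönwall: `Q e^{My}` increases and `Q e^{-My}` decreases, and both equal `1` at the origin. -/
theorem le_eval (h : NormalizedBound n a M Q) (hM : 0 ≤ M) {x : ℝ} (hx : x ∈ Set.Icc (-1 : ℝ) 1) :
    Real.exp (-M) ≤ Q.eval x ∧ Q.eval x ≤ Real.exp M := by
  have hd (c y : ℝ) : HasDerivAt (fun y => Q.eval y * Real.exp (c * y))
      (((derivative Q).eval y + c * Q.eval y) * Real.exp (c * y)) y := by
    have h1 := (Q.hasDerivAt y).mul (((hasDerivAt_id y).const_mul c).exp)
    simp only [id, mul_one] at h1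
    exact h1.congr_deriv (by ring)
  have hint : ∀ y ∈ interior (Set.Icc (-1 : ℝ) 1), y ∈ Set.Icc (-1 : ℝ) 1 :=
    fun y hy => interior_subset hy
  have hcont (c : ℝ) : ContinuousOn (fun y => Q.eval y * Real.exp (c * y)) (Set.Icc (-1 : ℝ) 1) :=
    fun y _ => (hd c y).continuousAt.continuousWithinAt
  have hmono : MonotoneOn (fun y => Q.eval y * Real.exp (M * y)) (Set.Icc (-1 : ℝ) 1) := by
    refine monotoneOn_of_deriv_nonneg (convex_Icc _ _) (hcont M)
      (fun y _ => (hd M y).differentiableAt.differentiableWithinAt) fun y hy => ?_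
    rw [(hd M y).deriv]
    have := (abs_le.mp (h.abs_derivative_le y (hint y hy))).1
    exact mul_nonneg (by linarith) (Real.exp_pos _).le
  have hanti : AntitoneOn (fun y => Q.eval y * Real.exp (-M * y)) (Set.Icc (-1 : ℝ) 1) := by
    refine antitoneOn_of_deriv_nonpos (convex_Icc _ _) (hcont (-M))
      (fun y _ => (hd (-M) y).differentiableAt.differentiableWithinAt) fun y hy => ?_
    rw [(hd (-M) y).deriv]
    have := (abs_le.mp (h.abs_derivative_le y (hint y hy))).2
    exact mul_nonpos_of_nonpos_of_nonneg (by linarith) (Real.exp_pos _).le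
  have h0 : (0 : ℝ) ∈ Set.Icc (-1 : ℝ) 1 := by constructor <;> norm_num
  have hexp (c : ℝ) : Real.exp (c * x) * Real.exp (-c * x) = 1 := by
    rw [← Real.exp_add]; simp
  have low (c : ℝ) (hc : 1 ≤ Q.eval x * Real.exp (c * x)) : Real.exp (-c * x) ≤ Q.eval x := by
    have := mul_le_mul_of_nonneg_right hc (Real.exp_pos (-c * x)).le
    rwa [mul_assoc, hexp, mul_one, one_mul] at this
  have upp (c : ℝ) (hc : Q.eval x * Real.exp (c * x) ≤ 1) : Q.eval x ≤ Real.exp (-c * x) := by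
    have := mul_le_mul_of_nonneg_right hc (Real.exp_pos (-c * x)).le
    rwa [mul_assoc, hexp, mul_one, one_mul] at this
  rcases le_total 0 x with hx0 | hx0
  · have h1 := hmono h0 hx hx0
    have h2 := hanti h0 hx hx0
    simp only [h.eval_zero, mul_zero, Real.exp_zero, mul_one] at h1 h2
    exact ⟨le_trans (Real.exp_le_exp.mpr (by nlinarith [hx.2])) (low M h1),
      (upp (-M) h2).trans (Real.exp_le_exp.mpr (by nlinarith [hx.2]))⟩
  · have h1 := hmono hx h0 hx0
    have h2 := hanti hx h0 hx0
    simp only [h.eval_zero, mul_zero, Real.exp_zero, mul_one] at h1 h2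
    exact ⟨le_trans (Real.exp_le_exp.mpr (by nlinarith [hx.1])) (low (-M) h2),
      (upp M h1).trans (Real.exp_le_exp.mpr (by nlinarith [hx.1]))⟩

theorem exists_fixedPole (h : NormalizedBound n a M Q) (hM : 0 ≤ M) :
    ∃ P ∈ FixedPole n a, PoleFree P ∧ unifNorm (logDer P) ≤ M := by
  have hQ : Q ≠ 0 := fun h0 => by simpa [h0] using h.eval_zero
  have hc : Q.leadingCoeff⁻¹ ≠ 0 := inv_ne_zero (leadingCoeff_ne_zero.mpr hQ)
  have hpos (x : ℝ) (hx : x ∈ Set.Icc (-1 : ℝ) 1) : 0 < Q.eval x :=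
    (Real.exp_pos _).trans_le (h.le_eval hM hx).1
  have hpf : PoleFree (Q * C Q.leadingCoeff⁻¹) := fun x hx => by
    simpa [hQ] using (hpos x hx).ne'
  refine ⟨Q * C Q.leadingCoeff⁻¹, ⟨monic_mul_leadingCoeff_inv hQ, ?_, ?_⟩, hpf,
    unifNorm_logDer_le hpf fun x hx => ?_⟩
  · rw [natDegree_mul_C hc]; exact h.natDegree_le
  · simp [IsRoot, h.eval_pole]
  · have := mul_le_mul_of_nonneg_right (h.abs_derivative_le x hx) (abs_nonneg Q.leadingCoeff⁻¹)
    rw [derivative_mul, derivative_C, mul_zero, add_zero, eval_mul, eval_C, eval_mul, eval_C,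
      abs_mul, abs_mul, abs_of_pos (hpos x hx), ← mul_assoc]
    exact this

theorem of_fixedPole {P : ℝ[X]} (hP : P ∈ FixedPole n a) (hpf : PoleFree P) :
    NormalizedBound n a (unifNorm (logDer P)) (C (P.eval 0)⁻¹ * P) := by
  have h0 : (0 : ℝ) ∈ Set.Icc (-1 : ℝ) 1 := by constructor <;> norm_num
  have hP0 := hpf 0 h0
  -- A sign change would force a zero in `[-1, 1]`.
  have hsign (x : ℝ) (hx : x ∈ Set.Icc (-1 : ℝ) 1) : 0 ≤ (P.eval 0)⁻¹ * P.eval x := by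
    by_contra! hneg
    have hcont : ContinuousOn (fun y => (P.eval 0)⁻¹ * P.eval y) (Set.Icc (-1 : ℝ) 1) :=
      (continuous_const.mul P.continuous).continuousOn
    obtain ⟨y, hy, hy0⟩ := isPreconnected_Icc.intermediate_value hx h0 hcont
      (show (0 : ℝ) ∈ _ from ⟨hneg.le, by simp [hP0]⟩)
    exact (mul_ne_zero (inv_ne_zero hP0) (hpf y hy)) hy0
  refine ⟨?_, ?_, ?_, fun x hx => ?_⟩
  · rw [natDegree_C_mul (inv_ne_zero hP0)]; exact hP.2.1
  · simp [hP.2.2.eq_zero]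
  · simp [hP0]
  · have := mul_le_mul_of_nonneg_left (abs_derivative_le_unifNorm_logDer_mul hpf hx)
      (abs_nonneg (P.eval 0)⁻¹)
    rw [derivative_C_mul, eval_mul, eval_C, eval_mul, eval_C, abs_mul,
      ← abs_of_nonneg (hsign x hx), abs_mul]
    linarith

/-- Among the normalized polynomials there is one with the least bound, by compactness of the set
of their values at `n + 1` nodes of `[-1, 1]`. -/
theorem exists_least {M₀ : ℝ} (hM₀ : 0 ≤ M₀) {Q₀ : ℝ[X]} (h₀ : NormalizedBound n a M₀ Q₀) :
    ∃ M Q, 0 ≤ M ∧ NormalizedBound n a M Q ∧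
      ∀ M' Q', 0 ≤ M' → NormalizedBound n a M' Q' → M ≤ M' := by
  -- Any `n + 1` distinct points of `[-1, 1]` would do: interpolation there parametrizes degree at
  -- most `n` by a finite-dimensional space.
  set v : Fin (n + 1) → ℝ := fun i => (i : ℝ) / (n + 1) with hv
  have hvI (i) : v i ∈ Set.Icc (-1 : ℝ) 1 := by
    have hi : ((i : ℕ) : ℝ) ≤ n := by exact_mod_cast Nat.lt_succ_iff.mp i.2
    exact ⟨by have : 0 ≤ v i := by positivity
              linarith, by rw [hv]; simp only; rw [div_le_one (by positivity)]; linarith⟩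
  have hinj : Set.InjOn v (Finset.univ : Finset (Fin (n + 1))) := fun i _ j _ hij => by
    have hn : (n : ℝ) + 1 ≠ 0 := by positivity
    simp only [hv, div_left_inj' hn, Nat.cast_inj] at hij
    exact Fin.ext hij
  let q : (Fin (n + 1) → ℝ) →ₗ[ℝ] ℝ[X] := Lagrange.interpolate Finset.univ v
  have hev (x : ℝ) : Continuous fun r => (q r).eval x :=
    ((leval x).comp q).continuous_of_finiteDimensional
  have hev' (x : ℝ) : Continuous fun r => (derivative (q r)).eval x :=
    ((leval x).comp (derivative.comp q)).continuous_of_finiteDimensional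
  have hdeg (r) : (q r).natDegree ≤ n := by
    have := Lagrange.degree_interpolate_lt r hinj
    rw [Finset.card_univ, Fintype.card_fin] at this
    exact natDegree_le_iff_coeff_eq_zero.mpr fun m hm => (degree_lt_iff_coeff_zero _ _).mp this m hm
  have hrep {Q : ℝ[X]} (hQ : Q.natDegree ≤ n) : q (fun i => Q.eval (v i)) = Q := by
    refine (Lagrange.eq_interpolate hinj ?_).symm
    rw [Finset.card_univ, Fintype.card_fin]
    exact (degree_le_of_natDegree_le hQ).trans_lt (by exact_mod_cast Nat.lt_succ_self n)
  let K : Set ((Fin (n + 1) → ℝ) × ℝ) :=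
    (Set.univ.pi (fun _ => Set.Icc 0 (Real.exp M₀)) ×ˢ Set.Icc 0 M₀) ∩
      {p | NormalizedBound n a p.2 (q p.1)}
  have hclosed : IsClosed {p : (Fin (n + 1) → ℝ) × ℝ | NormalizedBound n a p.2 (q p.1)} := by
    have : {p : (Fin (n + 1) → ℝ) × ℝ | NormalizedBound n a p.2 (q p.1)} =
        {p | (q p.1).eval a = 0} ∩ {p | (q p.1).eval 0 = 1} ∩
          ⋂ x ∈ Set.Icc (-1 : ℝ) 1, {p | |(derivative (q p.1)).eval x| ≤ p.2 * (q p.1).eval x} := by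
      ext p
      simp only [Set.mem_inter_iff, Set.mem_ofPred_eq, Set.mem_iInter]
      exact ⟨fun h => ⟨⟨h.eval_pole, h.eval_zero⟩, h.abs_derivative_le⟩,
        fun h => ⟨hdeg _, h.1.1, h.1.2, h.2⟩⟩
    rw [this]
    refine ((isClosed_eq ((hev a).comp continuous_fst) continuous_const).inter
      (isClosed_eq ((hev 0).comp continuous_fst) continuous_const)).inter
      (isClosed_biInter fun x _ => isClosed_le ((hev' x).comp continuous_fst).abs
        (continuous_snd.mul ((hev x).comp continuous_fst)))
  have hK : IsCompact K :=
    ((isCompact_univ_pi fun _ => isCompact_Icc).prod isCompact_Icc).inter_right hclosed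
  have hmem {M : ℝ} {Q : ℝ[X]} (hM : 0 ≤ M) (hMM : M ≤ M₀) (h : NormalizedBound n a M Q) :
      (fun i => Q.eval (v i), M) ∈ K := by
    refine ⟨⟨fun i _ => ?_, hM, hMM⟩, ?_⟩
    · have := h.le_eval hM (hvI i)
      exact ⟨(Real.exp_pos _).le.trans this.1, this.2.trans (Real.exp_le_exp.mpr hMM)⟩
    · show NormalizedBound n a M (q _)
      rwa [hrep h.natDegree_le]
  obtain ⟨p, hp, hmin⟩ := hK.exists_isMinOn ⟨_, hmem hM₀ le_rfl h₀⟩ continuous_snd.continuousOn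
  refine ⟨p.2, q p.1, hp.1.2.1, hp.2, fun M' Q' hM' h' => ?_⟩
  rcases le_total M' M₀ with hle | hle
  · exact hmin (hmem hM' hle h')
  · exact hp.1.2.2.trans hle

end NormalizedBound

theorem exists_isLeastDeviating {n : ℕ} (hn : 1 ≤ n) {a : ℝ} (ha : 1 < a) :
    ∃ P, IsLeastDeviating n a P := by
  have hX : X - C a ∈ FixedPole n a := ⟨monic_X_sub_C a, by simpa using hn, by simp⟩
  have hpf : PoleFree (X - C a) := fun x hx => by
    simpa [sub_eq_zero] using (hx.2.trans_lt ha).ne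
  obtain ⟨M, Q, hM, hQ, hmin⟩ :=
    NormalizedBound.exists_least (unifNorm_nonneg _) (NormalizedBound.of_fixedPole hX hpf)
  obtain ⟨P, hP, hPpf, hle⟩ := hQ.exists_fixedPole hM
  exact ⟨P, hP, hPpf, fun R hR hRpf =>
    hle.trans (hmin _ _ (unifNorm_nonneg _) (NormalizedBound.of_fixedPole hR hRpf))⟩

/-! ### Chebyshev extremality and the two bounds on the norm -/

open Chebyshev in
theorem neg_mul_eval_T_le_eval {m : ℕ} {p : ℝ[X]} (hdeg : p.degree ≤ m) {c : ℝ} (hc : 0 ≤ c)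
    (hp : ∀ x ∈ Set.Icc (-1 : ℝ) 1, |p.eval x| ≤ c) {x : ℝ} (hx : 1 ≤ x) :
    -(c * (T ℝ m).eval x) ≤ p.eval x := by
  -- The rescaling by `-c⁻¹` needs `c ≠ 0`.
  rcases hc.eq_or_lt with rfl | hc
  · have : p = 0 := eq_zero_of_infinite_isRoot p <|
      (Set.Icc_infinite (show (-1 : ℝ) < 1 by norm_num)).mono fun y hy =>
        abs_eq_zero.mp (le_antisymm (hp y hy) (abs_nonneg _))
    simp [this]
  · have := eval_iterate_derivative_le_of_forall_abs_le_one (k := 0) (P := C (-c⁻¹) * p) hx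
      ((degree_C_mul (neg_ne_zero.mpr (inv_ne_zero hc.ne'))).trans_le hdeg) fun y hy => by
        rw [eval_mul, eval_C, abs_mul, abs_neg, abs_of_pos (inv_pos.mpr hc), inv_mul_le_one₀ hc]
        exact hp y hy
    simp only [Function.iterate_zero, id, eval_mul, eval_C] at this
    have h2 := mul_le_mul_of_nonneg_left this hc.le
    rw [← mul_assoc, mul_neg, mul_inv_cancel₀ hc.ne'] at h2
    linarith

/-- The primitive `T_{k+2} / (2(k+2)) - T_k / (2k)` of `T_{k+1}`. -/
noncomputable def chebPrimitive (k : ℕ) : ℝ[X] :=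
  C (1 / (2 * ((k : ℝ) + 2))) * Chebyshev.T ℝ ((k : ℤ) + 2) - C (1 / (2 * (k : ℝ))) * Chebyshev.T ℝ k

theorem derivative_chebPrimitive {k : ℕ} (hk : k ≠ 0) :
    derivative (chebPrimitive k) = Chebyshev.T ℝ ((k : ℤ) + 1) := by
  have hk' : (k : ℝ) ≠ 0 := Nat.cast_ne_zero.mpr hk
  have hk2 : (k : ℝ) + 2 ≠ 0 := by positivity
  refine Polynomial.funext fun x => ?_
  have h := congrArg (eval x) (Chebyshev.two_mul_T_eq_U_sub_U ℝ ((k : ℤ) - 1))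
  rw [show (k : ℤ) - 1 + 2 = k + 1 by ring] at h
  simp only [eval_mul, eval_sub, eval_ofNat] at h
  simp only [chebPrimitive, derivative_sub, derivative_C_mul, Chebyshev.T_derivative_eq_U,
    show (k : ℤ) + 2 - 1 = k + 1 by ring, eval_sub, eval_mul, eval_C]
  push_cast
  simp only [eval_add, eval_natCast, eval_ofNat]
  field_simp
  linarith

theorem eval_chebPrimitive (k : ℕ) (x : ℝ) : (chebPrimitive k).eval x =
    1 / (2 * ((k : ℝ) + 2)) * (Chebyshev.T ℝ ((k : ℤ) + 2)).eval x
      - 1 / (2 * (k : ℝ)) * (Chebyshev.T ℝ k).eval x := by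
  simp [chebPrimitive]

theorem NormalizedBound.one_le_mul_exp {k : ℕ} (hk : k ≠ 0) {a M : ℝ} (ha : 1 ≤ a) (hM : 0 ≤ M)
    {Q : ℝ[X]} (h : NormalizedBound (k + 2) a M Q) :
    1 ≤ M * Real.exp (2 * M) * ((chebPrimitive k).eval a - (chebPrimitive k).eval 1) := by
  set c := M * Real.exp M with hc
  have hc0 : 0 ≤ c := by positivity
  have hmono : MonotoneOn (fun y => (Q + C c * chebPrimitive k).eval y) (Set.Icc 1 a) := by
    refine monotoneOn_of_deriv_nonneg (convex_Icc _ _) (Polynomial.continuous _).continuousOn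
      (Polynomial.differentiable _).differentiableOn fun y hy => ?_
    rw [Polynomial.deriv, derivative_add, derivative_C_mul, derivative_chebPrimitive hk, eval_add,
      eval_mul, eval_C]
    have := neg_mul_eval_T_le_eval (m := k + 1) (p := derivative Q) (c := c)
      ((degree_le_of_natDegree_le ((natDegree_derivative_le Q).trans
        (Nat.sub_le_of_le_add h.natDegree_le)))) hc0
      (fun x hx => (h.abs_derivative_le x hx).trans
        (mul_le_mul_of_nonneg_left (h.le_eval hM hx).2 hM)) (interior_subset hy).1
    push_cast at this
    linarith
  have h1 := hmono ⟨le_rfl, ha⟩ ⟨ha, le_rfl⟩ ha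
  simp only [eval_add, eval_mul, eval_C, h.eval_pole] at h1
  have h2 := (h.le_eval hM (x := 1) (by constructor <;> norm_num)).1
  have h3 : Real.exp (-M) ≤ c * ((chebPrimitive k).eval a - (chebPrimitive k).eval 1) := by
    linarith
  have h4 := mul_le_mul_of_nonneg_left h3 (Real.exp_pos M).le
  rw [← Real.exp_add, add_neg_cancel, Real.exp_zero, hc] at h4
  rw [two_mul M, Real.exp_add]
  linarith

/-- The right side exceeds the left by `(1/(2k) - 1/(2(k+2))) (T_k(a) - 1)`. -/
theorem eval_chebPrimitive_sub_le {k : ℕ} (hk : k ≠ 0) {a : ℝ} (ha : 1 ≤ a) :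
    (chebPrimitive k).eval a - (chebPrimitive k).eval 1 ≤
      ((Chebyshev.T ℝ ((k : ℤ) + 2)).eval a - (Chebyshev.T ℝ k).eval a) / (2 * ((k : ℝ) + 2)) := by
  have hk' : (0 : ℝ) < k := Nat.cast_pos.mpr (Nat.pos_of_ne_zero hk)
  have hT := Chebyshev.one_le_eval_T_real k ha
  rw [eval_chebPrimitive, eval_chebPrimitive, Chebyshev.T_eval_one, Chebyshev.T_eval_one]
  have : 1 / (2 * ((k : ℝ) + 2)) ≤ 1 / (2 * (k : ℝ)) :=
    one_div_le_one_div_of_le (by positivity) (by linarith)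
  have hsplit (s t : ℝ) : (s - t) / (2 * ((k : ℝ) + 2)) =
      1 / (2 * ((k : ℝ) + 2)) * s - 1 / (2 * ((k : ℝ) + 2)) * t := by ring
  rw [hsplit]
  nlinarith

theorem IsLeastDeviating.unifNorm_le {k : ℕ} (hk : k ≠ 0) {a : ℝ} {P : ℝ[X]}
    (hP : IsLeastDeviating (k + 2) a P)
    (hpos : 0 < (chebPrimitive k).eval a - (1 / (2 * ((k : ℝ) + 2)) + 1 / (2 * (k : ℝ)))) :
    unifNorm (logDer P) ≤
      1 / ((chebPrimitive k).eval a - (1 / (2 * ((k : ℝ) + 2)) + 1 / (2 * (k : ℝ)))) := by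
  set δ := (chebPrimitive k).eval a - (1 / (2 * ((k : ℝ) + 2)) + 1 / (2 * (k : ℝ))) with hδ
  have hT (j : ℤ) (x : ℝ) (hx : x ∈ Set.Icc (-1 : ℝ) 1) : |(Chebyshev.T ℝ j).eval x| ≤ 1 :=
    Chebyshev.abs_eval_T_real_le_one j (abs_le.mpr hx)
  -- The constant in `δ` bounds the primitive on `[-1, 1]`, by `|T_j| ≤ 1`.
  have hle (x : ℝ) (hx : x ∈ Set.Icc (-1 : ℝ) 1) :
      δ ≤ (chebPrimitive k).eval a - (chebPrimitive k).eval x := by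
    rw [hδ, eval_chebPrimitive k x]
    have h1 := (abs_le.mp (hT (k + 2) x hx)).2
    have h2 := (abs_le.mp (hT k x hx)).1
    have e1 : 0 ≤ 1 / (2 * ((k : ℝ) + 2)) := by positivity
    have e2 : 0 ≤ 1 / (2 * (k : ℝ)) := by positivity
    nlinarith
  have h0 := hpos.trans_le (hle 0 (by constructor <;> norm_num))
  set s := (chebPrimitive k).eval a - (chebPrimitive k).eval 0 with hs
  have hN : NormalizedBound (k + 2) a (1 / δ)
      (C s⁻¹ * (C ((chebPrimitive k).eval a) - chebPrimitive k)) := by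
    refine ⟨?_, by simp, ?_, fun x hx => ?_⟩
    · refine (natDegree_C_mul_le _ _).trans ((natDegree_sub_le _ _).trans (max_le (by simp) ?_))
      refine (natDegree_sub_le _ _).trans (max_le ?_ ?_) <;>
        refine (natDegree_C_mul_le _ _).trans ?_ <;> rw [Chebyshev.natDegree_T] <;> omega
    · rw [eval_mul, eval_C, eval_sub, eval_C, ← hs, inv_mul_cancel₀ h0.ne']
    · rw [derivative_C_mul, derivative_sub, derivative_C, derivative_chebPrimitive hk, zero_sub,
        eval_mul, eval_mul, eval_C, eval_neg, abs_mul, abs_neg, abs_of_pos (inv_pos.mpr h0),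
        eval_sub, eval_C, mul_left_comm]
      refine mul_le_mul_of_nonneg_left ?_ (inv_pos.mpr h0).le
      refine (hT _ x hx).trans ?_
      rw [one_div, ← div_eq_inv_mul, le_div_iff₀ hpos, one_mul]
      exact hle x hx
  obtain ⟨R, hR, hRpf, hRle⟩ := hN.exists_fixedPole (by positivity)
  exact (hP.2.2 R hR hRpf).trans hRle

/-! ### Growth of Chebyshev polynomials for `a ≥ √2` -/

section Growth

variable {a : ℝ}

theorem eval_U_pos_and_growth (ha : √2 ≤ a) (k : ℕ) :
    0 < (Chebyshev.U ℝ k).eval a ∧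
      9 / 5 * (Chebyshev.U ℝ k).eval a ≤ (Chebyshev.U ℝ ((k : ℤ) + 1)).eval a := by
  have h2 : (7 / 5 : ℝ) ≤ a := le_trans (Real.le_sqrt_of_sq_le (by norm_num)) ha
  induction k with
  | zero => simp; linarith
  | succ k ih =>
    have h := congrArg (eval a) (Chebyshev.U_add_two ℝ k)
    simp only [eval_sub, eval_mul, eval_X, eval_ofNat] at h
    push_cast
    rw [show (k : ℤ) + 1 + 1 = k + 2 by ring, h]
    refine ⟨by linarith [ih.1, ih.2], by nlinarith [ih.1, ih.2]⟩

theorem pow_le_eval_U (ha : √2 ≤ a) (k : ℕ) :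
    (9 / 5 : ℝ) ^ k ≤ (Chebyshev.U ℝ k).eval a := by
  induction k with
  | zero => simp
  | succ k ih =>
    have := (eval_U_pos_and_growth ha k).2
    push_cast
    rw [pow_succ]
    linarith

theorem add_three_le_mul_eval_U (ha : √2 ≤ a) (k : ℕ) :
    (k : ℝ) + 3 ≤ a * (Chebyshev.U ℝ ((k : ℤ) + 1)).eval a := by
  have ha0 : 0 ≤ a := (Real.sqrt_nonneg 2).trans ha
  have ha2 : 2 ≤ a ^ 2 := by
    have := Real.sq_sqrt (show (0 : ℝ) ≤ 2 by norm_num)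
    nlinarith [Real.sqrt_nonneg 2]
  induction k with
  | zero => simp; nlinarith
  | succ k ih =>
    have := mul_le_mul_of_nonneg_left (eval_U_pos_and_growth ha (k + 1)).2 ha0
    push_cast at this ⊢
    nlinarith [(Nat.cast_nonneg k : (0 : ℝ) ≤ k)]

theorem eval_T_add_le_eval_U (ha : √2 ≤ a) {k : ℕ} (hk : 2 ≤ k) :
    (Chebyshev.T ℝ k).eval a + k + 1 ≤ (Chebyshev.U ℝ k).eval a := by
  obtain ⟨j, rfl⟩ := Nat.exists_eq_add_of_le' hk
  have h := congrArg (eval a) (Chebyshev.U_eq_X_mul_U_add_T ℝ ((j : ℤ) + 1))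
  simp only [eval_add, eval_mul, eval_X, show (j : ℤ) + 1 + 1 = j + 2 by ring] at h
  have := add_three_le_mul_eval_U ha j
  push_cast
  linarith

/-- The difference equals `2 (a² - 1) U_k(a)`, and `a² - 1 ≥ 1`. -/
theorem two_mul_eval_U_le (ha : √2 ≤ a) (k : ℕ) :
    2 * (Chebyshev.U ℝ k).eval a ≤
      (Chebyshev.T ℝ ((k : ℤ) + 2)).eval a - (Chebyshev.T ℝ k).eval a := by
  have ha2 : 2 ≤ a ^ 2 := by
    have := Real.sq_sqrt (show (0 : ℝ) ≤ 2 by norm_num)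
    nlinarith [Real.sqrt_nonneg 2]
  have h1 := congrArg (eval a) (Chebyshev.one_sub_X_sq_mul_U_eq_pol_in_T ℝ k)
  have h2 := congrArg (eval a) (Chebyshev.T_add_two ℝ k)
  simp only [eval_sub, eval_mul, eval_X, eval_one, eval_pow, eval_ofNat] at h1 h2
  have := (eval_U_pos_and_growth ha k).1
  nlinarith

end Growth

/-! ### The ratio and its limit -/

theorem chebRate_add_two (k : ℕ) (a : ℝ) : chebRate (k + 2) a = 2 * ((k : ℝ) + 2) /
    ((Chebyshev.T ℝ ((k : ℤ) + 2)).eval a - (Chebyshev.T ℝ k).eval a) := by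
  simp [chebRate]

/-- In the `min`, the `1` serves the absolute constant, the other term the limit; neither depends on
`a`. -/
theorem IsLeastDeviating.ratio_bounds {k : ℕ} (hk : 2 ≤ k) {a : ℝ} (ha : √2 ≤ a) {P : ℝ[X]}
    (hP : IsLeastDeviating (k + 2) a P) :
    Real.exp (-(4 * min 1 (((k : ℝ) + 2) / (9 / 5) ^ k))) ≤
        unifNorm (logDer P) / chebRate (k + 2) a ∧
      unifNorm (logDer P) / chebRate (k + 2) a ≤ (k : ℝ) / (k - 1) := by
  have hk0 : k ≠ 0 := by omega
  have hk2 : (2 : ℝ) ≤ k := by exact_mod_cast hk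
  have ha1 : 1 ≤ a := le_trans (Real.le_sqrt_of_sq_le (by norm_num)) ha
  have hU := pow_le_eval_U ha k
  have hTU := eval_T_add_le_eval_U ha hk
  have hD := two_mul_eval_U_le ha k
  have hT := Chebyshev.one_le_eval_T_real k ha1
  have hprim := eval_chebPrimitive_sub_le hk0 ha1
  have hlow := (NormalizedBound.of_fixedPole hP.1 hP.2.1).one_le_mul_exp hk0 ha1
    (unifNorm_nonneg _)
  have hupp := hP.unifNorm_le hk0
  have hM := unifNorm_nonneg (logDer P)
  rw [chebRate_add_two]
  rw [eval_chebPrimitive] at hupp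
  set M := unifNorm (logDer P)
  set D := (Chebyshev.T ℝ ((k : ℤ) + 2)).eval a - (Chebyshev.T ℝ k).eval a with hDdef
  set t := (Chebyshev.T ℝ k).eval a
  set u := (Chebyshev.U ℝ k).eval a
  have hDpos : 0 < D := by linarith
  have hkp : (0 : ℝ) < k := by linarith
  -- Equivalent to `t + k + 1 ≤ D / 2`, which follows through `u`.
  have hden : D / (2 * ((k : ℝ) + 2)) * ((k - 1) / k) ≤
      1 / (2 * ((k : ℝ) + 2)) * (Chebyshev.T ℝ ((k : ℤ) + 2)).eval a - 1 / (2 * (k : ℝ)) * t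
        - (1 / (2 * ((k : ℝ) + 2)) + 1 / (2 * (k : ℝ))) := by
    rw [show (Chebyshev.T ℝ ((k : ℤ) + 2)).eval a = D + t by ring, ← sub_nonneg]
    have : 0 ≤ (D / 2 - (t + k + 1)) / (k * (k + 2)) :=
      div_nonneg (by linarith) (by positivity)
    convert this using 1
    field_simp
    ring
  have hpos : 0 < D / (2 * ((k : ℝ) + 2)) * ((k - 1) / k) :=
    mul_pos (by positivity) (div_pos (by linarith) hkp)
  have hMle : M / (2 * ((k : ℝ) + 2) / D) ≤ k / (k - 1) := by
    have h1 := (hupp (hpos.trans_le hden)).trans (one_div_le_one_div_of_le hpos hden)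
    rw [div_le_iff₀ (by positivity)]
    convert h1 using 1
    have : (k : ℝ) - 1 ≠ 0 := by linarith
    field_simp
  refine ⟨?_, hMle⟩
  set r := 2 * ((k : ℝ) + 2) / D with hr
  have hrpos : 0 < r := by positivity
  -- The upper bound feeds back to control `e^{2M}` in the lower one.
  have hMr : M ≤ 2 * r := by
    have : (k : ℝ) / (k - 1) ≤ 2 := by rw [div_le_iff₀ (by linarith)]; linarith
    exact (div_le_iff₀ hrpos).mp (hMle.trans this)
  have hru : r ≤ (k + 2) / u := by
    rw [hr, div_le_div_iff₀ hDpos (by linarith)]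
    nlinarith
  have hrmin : r ≤ min 1 (((k : ℝ) + 2) / (9 / 5) ^ k) := by
    refine le_min (hru.trans ((div_le_one (by linarith)).mpr (by linarith))) (hru.trans ?_)
    exact div_le_div_of_nonneg_left (by positivity) (by positivity) hU
  have hrM : r ≤ M * Real.exp (2 * M) := by
    have h1 : 1 ≤ M * Real.exp (2 * M) * (D / (2 * ((k : ℝ) + 2))) :=
      hlow.trans (mul_le_mul_of_nonneg_left hprim (by positivity))
    rw [hr, div_le_iff₀ hDpos]
    rwa [← mul_div_assoc, one_le_div (by positivity)] at h1
  rw [le_div_iff₀ hrpos]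
  calc _ ≤ Real.exp (-(2 * M)) * r := by
        refine mul_le_mul_of_nonneg_right (Real.exp_le_exp.mpr ?_) hrpos.le
        linarith
    _ ≤ Real.exp (-(2 * M)) * (M * Real.exp (2 * M)) :=
        mul_le_mul_of_nonneg_left hrM (Real.exp_pos _).le
    _ = M := by
        rw [mul_left_comm, ← Real.exp_add, neg_add_cancel, Real.exp_zero, mul_one]

theorem Admissible.sqrt_two_le {n : ℕ} {a : ℝ} (h : Admissible n a) : √2 ≤ a := by
  have hn : (1 : ℝ) ≤ n := by exact_mod_cast (by norm_num : 1 ≤ 4).trans h.1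
  have h1 : (1 : ℝ) ≤ 3 * √(n : ℝ) := by
    have := Real.one_le_sqrt.mpr hn
    linarith
  have h2 : (1 : ℝ) ≤ (3 * √(n : ℝ)) ^ (1 / (n : ℝ)) := Real.one_le_rpow h1 (by positivity)
  exact (le_mul_of_one_le_right (Real.sqrt_nonneg 2) h2).trans h.2.le

open Filter Topology in
theorem tendsto_ratio_lower :
    Tendsto (fun k : ℕ => Real.exp (-(4 * min 1 (((k : ℝ) + 2) / (9 / 5) ^ k)))) atTop (𝓝 1) := by
  have h1 : Tendsto (fun k : ℕ => ((k : ℝ) + 2) / (9 / 5) ^ k) atTop (𝓝 0) := by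
    have e1 := tendsto_pow_const_div_const_pow_of_one_lt 1 (show (1 : ℝ) < 9 / 5 by norm_num)
    have e2 := (tendsto_pow_const_div_const_pow_of_one_lt 0
      (show (1 : ℝ) < 9 / 5 by norm_num)).const_mul 2
    have := e1.add e2
    simp only [pow_one, pow_zero, mul_zero, add_zero] at this
    refine this.congr fun k => ?_
    ring
  have h2 := ((tendsto_const_nhds (x := (1 : ℝ))).min h1).const_mul 4 |>.neg.rexp
  simpa using h2

open Filter Topology in
theorem tendsto_ratio_upper : Tendsto (fun k : ℕ => (k : ℝ) / (k - 1)) atTop (𝓝 1) := by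
  simpa [sub_eq_add_neg] using tendsto_natCast_div_add_atTop (-1 : ℝ)

theorem mainTheorem2 :
    (∀ (n : ℕ) (a : ℝ), Admissible n a → ∃ P : ℝ[X], IsLeastDeviating n a P) ∧
    (∃ α β : ℝ, 0 < α ∧ ∀ (n : ℕ) (a : ℝ), Admissible n a →
      ∀ P : ℝ[X], IsLeastDeviating n a P →
        α ≤ unifNorm (logDer P) / chebRate n a ∧ unifNorm (logDer P) / chebRate n a ≤ β) ∧
    (∀ ε : ℝ, 0 < ε → ∃ N : ℕ, ∀ (n : ℕ) (a : ℝ), N ≤ n → Admissible n a →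
      ∀ P : ℝ[X], IsLeastDeviating n a P →
        |unifNorm (logDer P) / chebRate n a - 1| < ε) := by
  refine ⟨fun n a h => ?_, ⟨Real.exp (-4), 2, Real.exp_pos _, fun n a h P hP => ?_⟩,
    fun ε hε => ?_⟩
  · refine exists_isLeastDeviating (by linarith [h.1]) (lt_of_lt_of_le ?_ h.sqrt_two_le)
    exact Real.lt_sqrt_of_sq_lt (by norm_num)
  · obtain ⟨k, rfl⟩ := Nat.exists_eq_add_of_le' ((by norm_num : 2 ≤ 4).trans h.1)
    have hk : 2 ≤ k := by linarith [h.1]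
    have hk' : (2 : ℝ) ≤ k := by exact_mod_cast hk
    have hb := hP.ratio_bounds hk h.sqrt_two_le
    refine ⟨le_trans (Real.exp_le_exp.mpr ?_) hb.1, hb.2.trans ?_⟩
    · linarith [min_le_left 1 (((k : ℝ) + 2) / (9 / 5) ^ k)]
    · rw [div_le_iff₀ (by linarith)]; linarith
  · obtain ⟨N, hN⟩ := Filter.eventually_atTop.mp
      ((tendsto_ratio_lower.eventually_const_lt (show 1 - ε < 1 by linarith)).and
        (tendsto_ratio_upper.eventually_lt_const (show 1 < 1 + ε by linarith)))
    -- The limits are in `k = n - 2`.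
    refine ⟨N + 2, fun n a hn h P hP => ?_⟩
    obtain ⟨k, rfl⟩ := Nat.exists_eq_add_of_le' ((by norm_num : 2 ≤ 4).trans h.1)
    have hb := hP.ratio_bounds (by linarith [h.1]) h.sqrt_two_le
    have hk := hN k (by linarith)
    rw [abs_lt]
    constructor <;> linarith [hb.1, hb.2, hk.1, hk.2]
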